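/- Let $d\ge 1$ be an integer and let $\mathbb T^d=(\mathbb R/2\pi\mathbb Z)^d$ carry the normalized Lebesgue measure; write $\|g\|_1=(2\pi)^{-d}\int_{\mathbb T^d}|g(\mathbf x)|\,d\mathbf x$ and $\|g\|_\infty=\sup_{\mathbf x\in\mathbb T^d}|g(\mathbf x)|$. For $t\in\mathbb R$ and $1\le j\le d$ let $\Delta_{t,j}g(\mathbf x)=g(\mathbf x+t\mathbf e_j)-g(\mathbf x)$, where $\mathbf e_j$ is the $j$-th coordinate vector, and let $\Delta^l_{t,j}$ be the $l$-th iterate of this operator. For $e\subseteq\{1,\dots,d\}$ and $\mathbf t\in\mathbb R^d$ put $\Delta^l_{\mathbf t}(e)=\prod_{j\in e}\Delta^l_{t_j,j}$, with $\Delta^l_{\mathbf t}(\varnothing)$ the identity. For $r>0$ let $\mathbf H^r_\infty$ be the class of all continuous functions $f:\mathbb T^d\to\mathbb C$ such that, with $l=[r]+1$, $$\|\Delta^l_{\mathbf t}(e)f\|_\infty\le\prod_{j\in e}|t_j|^r\qquad\text{for all } e\subseteq\{1,\dots,d\}\text{ and all }\mathbf t\in\mathbb R^d .$$ For an integer $m\ge1$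 let $$\varrho_m^o(\mathbf H^r_\infty,L_1)=\inf_{\xi}\ \inf_{\mathcal M}\ \sup_{f\in\mathbf H^r_\infty}\bigl\|f-\mathcal M\bigl(f(\xi^1),\dots,f(\xi^m)\bigr)\bigr\|_1 ,$$ where $\xi$ ranges over all sets $\{\xi^1,\dots,\xi^m\}$ of $m$ points of $\mathbb T^d$ and $\mathcal M$ ranges over all (not necessarily linear) mappings $\mathbb C^m\to L_1(\mathbb T^d)$. Proposition 1.2. For every $d\ge1$ and $r>0$ there is a constant $c=c(r,d)>0$ such that for all integers $m\ge 1$ $$\varrho_m^o(\mathbf H^r_\infty,L_1)\ \ge\ c\,m^{-r}(\log m)^{d-1}$$ (with $(\log 1)^0=1$ when $d=1$). -/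

import Mathlib

open MeasureTheory
open scoped ENNReal

noncomputable section

instance fact_zero_lt_two_mul_pi : Fact ((0 : ℝ) < 2 * Real.pi) := ⟨Real.two_pi_pos⟩

/-- The torus `𝕋^d`: the `d`-fold product of the circle `ℝ / 2πℤ`.  Functions on it are the
functions of `d` real variables that are `2π`-periodic in each variable. -/
abbrev Torus (d : ℕ) : Type := Fin d → AddCircle (2 * Real.pi)

/-- The normalized Lebesgue measure `(2π)^{-d} dx` on `𝕋^d`. -/
def torusMeasure (d : ℕ) : Measure (Torus d) :=
  Measure.pi fun _ => AddCircle.haarAddCircle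

/-- The `l`-th difference `Δ^l_{τ,j} g` with step `τ` in the variable `x_j`, i.e. the `l`-th iterate
of the operator sending `g` to `x ↦ g (x + τ e_j) - g x`. -/
def coordDiff {d : ℕ} (l : ℕ) (j : Fin d) (τ : ℝ) (g : Torus d → ℂ) : Torus d → ℂ :=
  (fwdDiff (Pi.single j (τ : AddCircle (2 * Real.pi)) : Torus d))^[l] g

/-- The mixed difference `Δ^l_t(e) g = (∏_{j ∈ e} Δ^l_{t_j,j}) g`; the operators are applied in
increasing order of `j`, and `Δ^l_t(∅)` is the identity. -/
def mixedDiff {d : ℕ} (l : ℕ) (e : Finset (Fin d)) (t : Fin d → ℝ) (g : Torus d → ℂ) :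
    Torus d → ℂ :=
  ((List.finRange d).filter (fun j => j ∈ e)).foldl (fun h j => coordDiff l j (t j) h) g

/-- The class `𝐇^r_∞` of functions on `𝕋^d`: with `l = [r] + 1`, all `f` such that
`‖Δ^l_t(e) f‖_∞ ≤ ∏_{j ∈ e} |t_j|^r` for all `e ⊆ {1, …, d}` and all steps `t`, where `‖·‖_∞` is
the supremum over `𝕋^d`. -/
def classHInfty (d : ℕ) (r : ℝ) : Set C(Torus d, ℂ) :=
  {f | ∀ (e : Finset (Fin d)) (t : Fin d → ℝ) (x : Torus d),
    ‖mixedDiff (⌊r⌋₊ + 1) e t f x‖ ≤ ∏ j ∈ e, |t j| ^ r}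

/-- The error of optimal (nonlinear) sampling recovery `ϱ_m^o(W, L_p(Ω, μ))`: the infimum over all
sets of `m` points `ξ^1, …, ξ^m` of `Ω` and over all mappings `M : ℂ^m → L_p(Ω, μ)` of
`sup_{f ∈ W} ‖f - M (f (ξ^1), …, f (ξ^m))‖_p`. -/
def optimalRecoveryError {Ω : Type*} [TopologicalSpace Ω] [MeasurableSpace Ω] (μ : Measure Ω)
    (W : Set C(Ω, ℂ)) (p : ℝ≥0∞) (m : ℕ) : ℝ≥0∞ :=
  ⨅ (ξ : Fin m ↪ Ω) (M : (Fin m → ℂ) → Lp ℂ p μ),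
    ⨆ f ∈ W, eLpNorm (fun x => f x - M (fun i => f (ξ i)) x) p μ

end

/-! If `f` and `-f` lie in the class and `f` vanishes at all nodes, both give the same data, so
every method errs by at least `‖f‖₁` on one of them (`le_optimalRecoveryError_of_forall_exists`). To
build such an `f`, take `n` with `2^n` between `2m` and `4m`. For each shape `s` with `∑ s i = n`,
cut the torus into `2^n` congruent dyadic boxes. At least half of them carry a bump vanishing at
every node. Let `f` be `c 2^{-rn}` times the sum of these bumps over about `n^{d-1}` shapes. The
bumps are nonnegative, so nothing cancels in `‖f‖₁`, and each shape contributes a constant times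
`2^{-rn}`.

The crux is that adding so many layers loses no logarithm in the class norm
(`exists_norm_mixedDiff_dyadicBumpSum_le`). Since `2^{-rn} = ∏ 2^{-r s_i}`, the bound for layer `s`
is a product over coordinates. Extending the sum to all `s` in `[0,n]^d` factors it into sums `∑_a
2^{-ra} min(1, 2^a τ)^l`, each at most `K τ^r` because `0 < r < l`. -/

/-! ### Finite differences of a smooth bump on the line -/

theorem norm_fwdDiff_iterate_le {l : ℕ} {g : ℝ → ℝ} (hg : ContDiff ℝ (⊤ : ℕ∞) g) {C : ℝ}
    (hC : ∀ y, ‖iteratedDeriv l g y‖ ≤ C) (t y : ℝ) :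
    ‖(fwdDiff t)^[l] g y‖ ≤ C * |t| ^ l := by
  induction l generalizing g C y with
  | zero => simpa using hC y
  | succ l ih =>
    have hshift : ContDiff ℝ (⊤ : ℕ∞) fun z => g (z + t) := hg.comp (contDiff_id.add contDiff_const)
    rw [Function.iterate_succ_apply, pow_succ', ← mul_assoc]
    refine ih (hshift.sub hg) (fun z => ?_) y
    have hle : (l : WithTop ℕ∞) ≤ (⊤ : ℕ∞) := by exact_mod_cast le_top
    have h1 : iteratedDeriv l (fwdDiff t g) z
        = iteratedDeriv l g (z + t) - iteratedDeriv l g z := by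
      unfold fwdDiff
      rw [iteratedDeriv_fun_sub (hshift.contDiffAt.of_le hle) (hg.contDiffAt.of_le hle),
        iteratedDeriv_comp_add_const]
    have hd : Differentiable ℝ (iteratedDeriv l g) :=
      hg.differentiable_iteratedDeriv l (by exact_mod_cast WithTop.coe_lt_top l)
    change ‖iteratedDeriv l (fwdDiff t g) z‖ ≤ _
    rw [h1]
    have := convex_univ.norm_image_sub_le_of_norm_deriv_le (f := iteratedDeriv l g) (C := C)
      (fun x _ => hd x) (fun x _ => by rw [← iteratedDeriv_succ]; exact hC x)
      (Set.mem_univ z) (Set.mem_univ (z + t))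
    simpa using this

/-- A smooth nonnegative function on the line that is positive exactly on `(0, 1)`. -/
noncomputable def bumpProfile (y : ℝ) : ℝ := expNegInvGlue y * expNegInvGlue (1 - y)

theorem contDiff_bumpProfile : ContDiff ℝ (⊤ : ℕ∞) bumpProfile :=
  (expNegInvGlue.contDiff (n := ⊤)).mul
    ((expNegInvGlue.contDiff (n := ⊤)).comp (contDiff_const.sub contDiff_id))

theorem bumpProfile_nonneg (y : ℝ) : 0 ≤ bumpProfile y :=
  mul_nonneg (expNegInvGlue.nonneg _) (expNegInvGlue.nonneg _)

theorem bumpProfile_pos {y : ℝ} (h0 : 0 < y) (h1 : y < 1) : 0 < bumpProfile y :=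
  mul_pos (expNegInvGlue.pos_of_pos h0) (expNegInvGlue.pos_of_pos (sub_pos.2 h1))

theorem bumpProfile_eq_zero {y : ℝ} (h : y ≤ 0 ∨ 1 ≤ y) : bumpProfile y = 0 := by
  rcases h with h | h
  · simp [bumpProfile, expNegInvGlue.zero_of_nonpos h]
  · simp [bumpProfile, expNegInvGlue.zero_of_nonpos (sub_nonpos.2 h)]

theorem bumpProfile_sub_intCast (z : ℝ) (q : ℤ) :
    bumpProfile (z - q) = if q = ⌊z⌋ then bumpProfile (Int.fract z) else 0 := by
  split_ifs with h
  · rw [h, Int.self_sub_floor]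
  · apply bumpProfile_eq_zero
    rcases lt_or_gt_of_ne h with h | h
    · right
      have : (q : ℝ) + 1 ≤ ⌊z⌋ := by exact_mod_cast h
      linarith [Int.floor_le z]
    · left
      have : (⌊z⌋ : ℝ) + 1 ≤ q := by exact_mod_cast h
      linarith [Int.lt_floor_add_one z]

theorem hasCompactSupport_bumpProfile : HasCompactSupport bumpProfile := by
  refine HasCompactSupport.intro (isCompact_Icc (a := (0 : ℝ)) (b := 1)) fun x hx => ?_
  apply bumpProfile_eq_zero
  by_contra! h
  exact hx ⟨h.1.le, h.2.le⟩

theorem exists_norm_iteratedDeriv_bumpProfile_le (l : ℕ) :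
    ∃ C, ∀ y, ‖iteratedDeriv l bumpProfile y‖ ≤ C := by
  have hc : Continuous (iteratedDeriv l bumpProfile) :=
    contDiff_bumpProfile.continuous_iteratedDeriv l (by exact_mod_cast le_top)
  have hs : HasCompactSupport (iteratedDeriv l bumpProfile) := by
    induction l with
    | zero => simpa using hasCompactSupport_bumpProfile
    | succ l ih =>
      rw [iteratedDeriv_succ]
      exact (ih (contDiff_bumpProfile.continuous_iteratedDeriv l
        (by exact_mod_cast le_top))).deriv
  exact hs.exists_bound_of_continuous hc

theorem norm_fwdDiff_iterate_le_two_pow {g : ℝ → ℝ} {C : ℝ} (hC : ∀ y, ‖g y‖ ≤ C) (l : ℕ)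
    (t y : ℝ) : ‖(fwdDiff t)^[l] g y‖ ≤ 2 ^ l * C := by
  induction l generalizing y with
  | zero => simpa using hC y
  | succ l ih =>
    rw [Function.iterate_succ_apply', fwdDiff]
    refine (norm_sub_le _ _).trans ?_
    rw [pow_succ]
    linarith [ih (y + t), ih y]

theorem exists_norm_fwdDiff_bumpProfile_le (l : ℕ) :
    ∃ C, 0 ≤ C ∧ ∀ t y, ‖(fwdDiff t)^[l] bumpProfile y‖ ≤ C * min 1 |t| ^ l := by
  obtain ⟨C, hC⟩ := exists_norm_iteratedDeriv_bumpProfile_le l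
  obtain ⟨D, hD⟩ := exists_norm_iteratedDeriv_bumpProfile_le 0
  simp only [iteratedDeriv_zero] at hD
  have hD0 : 0 ≤ 2 ^ l * D := mul_nonneg (by positivity) ((norm_nonneg _).trans (hD 0))
  have hC0 : 0 ≤ C := (norm_nonneg _).trans (hC 0)
  refine ⟨max C (2 ^ l * D), hC0.trans (le_max_left _ _), fun t y => ?_⟩
  rcases le_total 1 |t| with h | h
  · rw [min_eq_left h, one_pow, mul_one]
    exact (norm_fwdDiff_iterate_le_two_pow hD l t y).trans (le_max_right _ _)
  · rw [min_eq_right h]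
    refine (norm_fwdDiff_iterate_le contDiff_bumpProfile hC t y).trans ?_
    gcongr
    exact le_max_left _ _

/-! ### Periodized bumps -/

/-- The `N`-periodization of the bump supported on `[k, k + 1]`. -/
noncomputable def periodicBump (N k : ℕ) (y : ℝ) : ℝ :=
  if (N : ℤ) ∣ ⌊y⌋ - k then bumpProfile (Int.fract y) else 0

theorem periodicBump_nonneg (N k : ℕ) (y : ℝ) : 0 ≤ periodicBump N k y := by
  unfold periodicBump
  split_ifs
  exacts [bumpProfile_nonneg _, le_rfl]

theorem periodic_periodicBump (N k : ℕ) : Function.Periodic (periodicBump N k) N := by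
  intro y
  have h : ⌊y + (N : ℝ)⌋ - k = N + (⌊y⌋ - k) := by rw [Int.floor_add_natCast]; ring
  unfold periodicBump
  rw [h, Int.fract_add_natCast]
  simp

theorem eq_of_dvd_sub_of_lt {N k k' : ℕ} (hk : k < N) (hk' : k' < N) {q : ℤ}
    (h : (N : ℤ) ∣ q - k) (h' : (N : ℤ) ∣ q - k') : k = k' := by
  have h2 : (N : ℤ) ∣ (k' : ℤ) - k := by simpa using dvd_sub h h'
  have := Int.eq_zero_of_abs_lt_dvd h2 (by rw [abs_lt]; omega)
  omega

theorem eq_of_periodicBump_ne_zero {N k k' : ℕ} (hk : k < N) (hk' : k' < N) {y : ℝ}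
    (h : periodicBump N k y ≠ 0) (h' : periodicBump N k' y ≠ 0) : k = k' := by
  unfold periodicBump at h h'
  exact eq_of_dvd_sub_of_lt hk hk' (by_contra fun hn => h (if_neg hn))
    (by_contra fun hn => h' (if_neg hn))

/-- An `l`-th difference samples only `l + 1` points, each in one unit cell, so at most `l + 1`
integer translates of the profile contribute, whatever `N` is; each translate belongs to one residue
class `k`. -/
theorem sum_norm_fwdDiff_periodicBump_le {l : ℕ} {C : ℝ} (hC0 : 0 ≤ C) {t : ℝ}
    (hC : ∀ y, ‖(fwdDiff t)^[l] bumpProfile y‖ ≤ C) (N : ℕ) (y : ℝ) :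
    ∑ k ∈ Finset.range N, ‖(fwdDiff t)^[l] (periodicBump N k) y‖ ≤ (l + 1) * C := by
  -- Translates by integers outside `Q` vanish at every sampled point, so the periodization may be
  -- replaced by a finite sum over `Q`.
  set Q : Finset ℤ := (Finset.range (l + 1)).image fun i : ℕ => ⌊y + i • t⌋ with hQ
  have hval : ∀ k : ℕ, (fwdDiff t)^[l] (periodicBump N k) y
      = ∑ q ∈ Q with (N : ℤ) ∣ q - k, (fwdDiff t)^[l] bumpProfile (y - q) := by
    intro k
    simp only [fwdDiff_iter_eq_sum_shift]
    rw [Finset.sum_comm]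
    refine Finset.sum_congr rfl fun i hi => ?_
    rw [← Finset.smul_sum]
    congr 1
    have hmem : ⌊y + i • t⌋ ∈ Q := Finset.mem_image_of_mem _ hi
    have : ∀ q : ℤ, bumpProfile (y - q + i • t)
        = if q = ⌊y + i • t⌋ then bumpProfile (Int.fract (y + i • t)) else 0 := by
      intro q
      rw [← bumpProfile_sub_intCast]
      congr 1
      ring
    simp only [this, Finset.sum_ite_eq', Finset.mem_filter, hmem, true_and, periodicBump]
  calc ∑ k ∈ Finset.range N, ‖(fwdDiff t)^[l] (periodicBump N k) y‖
      ≤ ∑ k ∈ Finset.range N, ∑ q ∈ Q, if (N : ℤ) ∣ q - k then C else 0 := by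
        refine Finset.sum_le_sum fun k _ => ?_
        rw [hval, ← Finset.sum_filter]
        exact norm_sum_le_of_le _ fun q _ => hC _
    _ = ∑ q ∈ Q, ∑ k ∈ Finset.range N, if (N : ℤ) ∣ q - k then C else 0 := Finset.sum_comm
    _ ≤ ∑ q ∈ Q, C := by
        refine Finset.sum_le_sum fun q _ => ?_
        rw [← Finset.sum_filter, Finset.sum_const, nsmul_eq_mul]
        have : (Finset.card {k ∈ Finset.range N | (N : ℤ) ∣ q - ((k : ℕ) : ℤ)} : ℝ) ≤ 1 := by
          exact_mod_cast Finset.card_le_one.2 fun a ha b hb => by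
            simp only [Finset.mem_filter, Finset.mem_range] at ha hb
            exact eq_of_dvd_sub_of_lt ha.1 hb.1 ha.2 hb.2
        nlinarith
    _ ≤ (l + 1) * C := by
        rw [Finset.sum_const, nsmul_eq_mul]
        have : (Q.card : ℝ) ≤ l + 1 := by
          exact_mod_cast Finset.card_image_le.trans (Finset.card_range _).le
        gcongr

/-- The difference bound with `l = 1` and step `x - y` is a Lipschitz estimate. -/
theorem continuous_periodicBump {N k : ℕ} (hk : k < N) : Continuous (periodicBump N k) := by
  obtain ⟨C, hC0, hC⟩ := exists_norm_fwdDiff_bumpProfile_le 1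
  refine (LipschitzWith.of_dist_le_mul (K := (2 * C).toNNReal) fun x y => ?_).continuous
  have h := sum_norm_fwdDiff_periodicBump_le (l := 1) (t := x - y)
    (mul_nonneg hC0 (by positivity)) (hC (x - y)) N y
  have h2 := (Finset.single_le_sum (fun i _ => norm_nonneg _) (Finset.mem_range.2 hk)).trans h
  have h3 : fwdDiff (x - y) (periodicBump N k) y = periodicBump N k x - periodicBump N k y := by
    simp [fwdDiff]
  rw [Function.iterate_one, h3] at h2
  rw [dist_eq_norm, Real.dist_eq, Real.coe_toNNReal _ (by positivity)]
  refine h2.trans ?_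
  have := min_le_right 1 |x - y|
  norm_num
  nlinarith

theorem le_integral_periodicBump {N k : ℕ} (hk : k < N) :
    ∫ y in (0 : ℝ)..1, bumpProfile y ≤ ∫ y in (0 : ℝ)..N, periodicBump N k y := by
  have hkN : (k : ℝ) + 1 ≤ N := by exact_mod_cast hk
  have h1 : ∫ y in (k : ℝ)..(k + 1), periodicBump N k y = ∫ y in (0 : ℝ)..1, bumpProfile y := by
    have : ∫ y in (k : ℝ)..(k + 1), bumpProfile (y - k) = ∫ y in (0 : ℝ)..1, bumpProfile y := by
      rw [intervalIntegral.integral_comp_sub_right bumpProfile (k : ℝ)]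
      simp
    rw [← this]
    refine intervalIntegral.integral_congr_Ioo_of_le (by linarith) fun y hy => ?_
    have hf : ⌊y⌋ = k := Int.floor_eq_iff.2 ⟨by exact_mod_cast hy.1.le, by exact_mod_cast hy.2⟩
    simp [periodicBump, Int.fract, hf]
  rw [← h1]
  exact intervalIntegral.integral_mono_interval (by positivity) (by linarith) hkN
    (Filter.Eventually.of_forall fun y => periodicBump_nonneg N k y)
    ((continuous_periodicBump hk).intervalIntegrable _ _)

theorem integral_bumpProfile_pos : 0 < ∫ y in (0 : ℝ)..1, bumpProfile y :=
  intervalIntegral.intervalIntegral_pos_of_pos_on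
    (contDiff_bumpProfile.continuous.intervalIntegrable _ _)
    (fun _ hx => bumpProfile_pos hx.1 hx.2) one_pos

/-! ### Bumps on the circle -/

theorem periodic_periodicBump_scaled (N k : ℕ) :
    Function.Periodic (fun x : ℝ => periodicBump N k (N / (2 * Real.pi) * x)) (2 * Real.pi) := by
  intro x
  have : (N : ℝ) / (2 * Real.pi) * (x + 2 * Real.pi) = N / (2 * Real.pi) * x + N := by
    have := Real.pi_ne_zero
    field_simp
  change periodicBump N k _ = _
  rw [this, periodic_periodicBump N k]

/-- The bump on the circle supported on the `k`-th of `N` equal arcs. -/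
noncomputable def circleBump (N k : ℕ) : AddCircle (2 * Real.pi) → ℝ :=
  (periodic_periodicBump_scaled N k).lift

@[simp]
theorem circleBump_coe (N k : ℕ) (x : ℝ) :
    circleBump N k (x : AddCircle (2 * Real.pi)) = periodicBump N k (N / (2 * Real.pi) * x) :=
  (periodic_periodicBump_scaled N k).lift_coe x

theorem circleBump_nonneg (N k : ℕ) (x : AddCircle (2 * Real.pi)) : 0 ≤ circleBump N k x := by
  induction x using QuotientAddGroup.induction_on with
  | H x => exact (circleBump_coe N k x).symm ▸ periodicBump_nonneg N k _

theorem eq_of_circleBump_ne_zero {N k k' : ℕ} (hk : k < N) (hk' : k' < N)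
    {x : AddCircle (2 * Real.pi)} (h : circleBump N k x ≠ 0) (h' : circleBump N k' x ≠ 0) :
    k = k' := by
  induction x using QuotientAddGroup.induction_on with
  | H x =>
    erw [circleBump_coe] at h h'
    exact eq_of_periodicBump_ne_zero hk hk' h h'

theorem continuous_circleBump {N k : ℕ} (hk : k < N) : Continuous (circleBump N k) := by
  refine continuous_coinduced_dom.2 ?_
  have : circleBump N k ∘ ((↑) : ℝ → AddCircle (2 * Real.pi))
      = fun x : ℝ => periodicBump N k (N / (2 * Real.pi) * x) := funext (circleBump_coe N k)
  exact this ▸ (continuous_periodicBump hk).comp (continuous_const.mul continuous_id)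

theorem fwdDiff_circleBump_coe (l N k : ℕ) (t x : ℝ) :
    (fwdDiff (t : AddCircle (2 * Real.pi)))^[l] (fun z => (circleBump N k z : ℂ)) x
      = ((fwdDiff (N / (2 * Real.pi) * t))^[l] (periodicBump N k) (N / (2 * Real.pi) * x) : ℝ) := by
  simp only [fwdDiff_iter_eq_sum_shift]
  push_cast
  refine Finset.sum_congr rfl fun i _ => ?_
  rw [← AddCircle.coe_nsmul, ← AddCircle.coe_add, circleBump_coe, mul_add, mul_smul_comm]

theorem exists_sum_norm_fwdDiff_circleBump_le (l : ℕ) :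
    ∃ C, 0 ≤ C ∧ ∀ (N : ℕ) (t : ℝ) (x : AddCircle (2 * Real.pi)),
      ∑ k ∈ Finset.range N,
        ‖(fwdDiff (t : AddCircle (2 * Real.pi)))^[l] (fun z => (circleBump N k z : ℂ)) x‖
        ≤ C * min 1 (N * |t|) ^ l := by
  obtain ⟨C, hC0, hC⟩ := exists_norm_fwdDiff_bumpProfile_le l
  refine ⟨(l + 1) * C, by positivity, fun N t x => ?_⟩
  induction x using QuotientAddGroup.induction_on with
  | H x =>
    have h := sum_norm_fwdDiff_periodicBump_le (mul_nonneg hC0 (by positivity))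
      (hC (N / (2 * Real.pi) * t)) N (N / (2 * Real.pi) * x)
    have h1 : |N / (2 * Real.pi) * t| ≤ N * |t| := by
      rw [abs_mul, abs_of_nonneg (by positivity)]
      gcongr
      exact div_le_self (by positivity) (by linarith [Real.pi_gt_three])
    calc _ = _ := Finset.sum_congr rfl fun k _ => by
          erw [fwdDiff_circleBump_coe, Complex.norm_real]
      _ ≤ _ := h
      _ ≤ _ := by
        rw [mul_assoc]
        gcongr

theorem le_integral_circleBump {N k : ℕ} (hk : k < N) :
    (∫ y in (0 : ℝ)..1, bumpProfile y) / N
      ≤ ∫ x, circleBump N k x ∂AddCircle.haarAddCircle := by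
  have hN : (0 : ℝ) < N := by exact_mod_cast (Nat.zero_le k).trans_lt hk
  have hpi := Real.two_pi_pos
  rw [AddCircle.integral_haarAddCircle, ← AddCircle.intervalIntegral_preimage _ 0]
  simp only [circleBump_coe]
  rw [intervalIntegral.integral_comp_mul_left (periodicBump N k) (by positivity)]
  have h2 : (N : ℝ) / (2 * Real.pi) * (0 + 2 * Real.pi) = N := by field_simp; ring
  rw [h2, mul_zero, smul_smul]
  have h3 : (2 * Real.pi)⁻¹ * ((N : ℝ) / (2 * Real.pi))⁻¹ = (N : ℝ)⁻¹ := by field_simp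
  rw [h3, smul_eq_mul, div_eq_inv_mul]
  gcongr
  exact le_integral_periodicBump hk

/-! ### Mixed differences of tensor-product bumps -/

section MixedDifferences

variable {d : ℕ}

theorem fwdDiff_prod (h : Fin d → AddCircle (2 * Real.pi) → ℂ) (j : Fin d)
    (τ : AddCircle (2 * Real.pi)) :
    fwdDiff (Pi.single j τ : Torus d) (fun x => ∏ i, h i (x i))
      = fun x => ∏ i, Function.update h j (fwdDiff τ (h j)) i (x i) := by
  funext x
  have hprod : ∀ (g : Fin d → AddCircle (2 * Real.pi) → ℂ) (z : Torus d),
      ∏ i, g i (z i) = g j (z j) * ∏ i ∈ Finset.univ.erase j, g i (z i) := fun g z =>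
    (Finset.mul_prod_erase _ _ (Finset.mem_univ j)).symm
  rw [fwdDiff, hprod h, hprod h x, hprod]
  have h1 : ∏ i ∈ Finset.univ.erase j, h i ((x + Pi.single j τ : Torus d) i)
      = ∏ i ∈ Finset.univ.erase j, h i (x i) :=
    Finset.prod_congr rfl fun i hi => by simp [Finset.ne_of_mem_erase hi]
  have h2 : ∏ i ∈ Finset.univ.erase j, Function.update h j (fwdDiff τ (h j)) i (x i)
      = ∏ i ∈ Finset.univ.erase j, h i (x i) :=
    Finset.prod_congr rfl fun i hi => by simp [Finset.ne_of_mem_erase hi]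
  rw [h1, h2]
  simp [fwdDiff, sub_mul]

theorem coordDiff_prod (l : ℕ) (h : Fin d → AddCircle (2 * Real.pi) → ℂ) (j : Fin d) (τ : ℝ) :
    coordDiff l j τ (fun x => ∏ i, h i (x i))
      = fun x => ∏ i, Function.update h j
          ((fwdDiff (τ : AddCircle (2 * Real.pi)))^[l] (h j)) i (x i) := by
  unfold coordDiff
  induction l with
  | zero => simp
  | succ l ih =>
    rw [Function.iterate_succ_apply', ih, fwdDiff_prod]
    simp [Function.iterate_succ_apply']

theorem foldl_coordDiff_prod (l : ℕ) (t : Fin d → ℝ) (L : List (Fin d)) (hL : L.Nodup)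
    (h : Fin d → AddCircle (2 * Real.pi) → ℂ) :
    L.foldl (fun g j => coordDiff l j (t j) g) (fun x => ∏ i, h i (x i))
      = fun x => ∏ i, (if i ∈ L then (fwdDiff (t i : AddCircle (2 * Real.pi)))^[l] (h i)
          else h i) (x i) := by
  induction L generalizing h with
  | nil => simp
  | cons j L ih =>
    rw [List.nodup_cons] at hL
    rw [List.foldl_cons, coordDiff_prod, ih hL.2]
    funext x
    refine Finset.prod_congr rfl fun i _ => ?_
    by_cases hij : i = j
    · subst hij
      simp [hL.1]
    · simp [hij]

theorem mixedDiff_prod (l : ℕ) (e : Finset (Fin d)) (t : Fin d → ℝ)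
    (h : Fin d → AddCircle (2 * Real.pi) → ℂ) :
    mixedDiff l e t (fun x => ∏ i, h i (x i))
      = fun x => ∏ i, (if i ∈ e then (fwdDiff (t i : AddCircle (2 * Real.pi)))^[l] (h i)
          else h i) (x i) := by
  rw [mixedDiff, foldl_coordDiff_prod l t _ ((List.nodup_finRange d).filter _)]
  simp

theorem mixedDiff_const_smul (l : ℕ) (e : Finset (Fin d)) (t : Fin d → ℝ) (c : ℂ)
    (g : Torus d → ℂ) : mixedDiff l e t (c • g) = c • mixedDiff l e t g := by
  unfold mixedDiff
  generalize (List.finRange d).filter (fun j => j ∈ e) = L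
  induction L generalizing g with
  | nil => rfl
  | cons j L ih => rw [List.foldl_cons, coordDiff, fwdDiff_iter_const_smul, ih]; rfl

theorem mixedDiff_sum {ι : Type*} (l : ℕ) (e : Finset (Fin d)) (t : Fin d → ℝ) (A : Finset ι)
    (g : ι → Torus d → ℂ) : mixedDiff l e t (∑ a ∈ A, g a) = ∑ a ∈ A, mixedDiff l e t (g a) := by
  unfold mixedDiff
  generalize (List.finRange d).filter (fun j => j ∈ e) = L
  induction L generalizing g with
  | nil => rfl
  | cons j L ih => rw [List.foldl_cons, coordDiff, fwdDiff_iter_finsetSum, ih]; rfl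

/-- The bump on the box `k` of the partition of the torus into `∏ i, N i` boxes. -/
noncomputable def boxBump (N k : Fin d → ℕ) (x : Torus d) : ℝ := ∏ i, circleBump (N i) (k i) (x i)

theorem boxBump_nonneg (N k : Fin d → ℕ) (x : Torus d) : 0 ≤ boxBump N k x :=
  Finset.prod_nonneg fun _ _ => circleBump_nonneg _ _ _

theorem eq_of_boxBump_ne_zero {N k k' : Fin d → ℕ} (hk : ∀ i, k i < N i) (hk' : ∀ i, k' i < N i)
    {x : Torus d} (h : boxBump N k x ≠ 0) (h' : boxBump N k' x ≠ 0) : k = k' :=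
  funext fun i => eq_of_circleBump_ne_zero (hk i) (hk' i)
    (Finset.prod_ne_zero_iff.1 h i (Finset.mem_univ i))
    (Finset.prod_ne_zero_iff.1 h' i (Finset.mem_univ i))

theorem continuous_boxBump {N k : Fin d → ℕ} (hk : ∀ i, k i < N i) : Continuous (boxBump N k) :=
  continuous_finsetProd _ fun i _ => (continuous_circleBump (hk i)).comp (continuous_apply i)

theorem le_integral_boxBump {N k : Fin d → ℕ} (hk : ∀ i, k i < N i) :
    (∫ y in (0 : ℝ)..1, bumpProfile y) ^ d / ∏ i, (N i : ℝ)
      ≤ ∫ x, boxBump N k x ∂torusMeasure d := by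
  unfold boxBump torusMeasure
  rw [integral_fintype_prod_eq_prod (fun i z => circleBump (N i) (k i) z)]
  have : (∫ y in (0 : ℝ)..1, bumpProfile y) ^ d / ∏ i, (N i : ℝ)
      = ∏ i, (∫ y in (0 : ℝ)..1, bumpProfile y) / N i := by simp [Finset.prod_div_distrib]
  rw [this]
  exact Finset.prod_le_prod (fun i _ => div_nonneg integral_bumpProfile_pos.le (by positivity))
    fun i _ => le_integral_circleBump (hk i)

/-- After taking norms, the sum over `A` is enlarged to the full grid of boxes, where it factors
into one-variable sums. The bound is therefore independent of which boxes are selected. -/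
theorem exists_norm_mixedDiff_boxBump_sum_le (l : ℕ) :
    ∃ C, 0 ≤ C ∧ ∀ (d : ℕ) (N : Fin d → ℕ) (A : Finset (Fin d → ℕ)),
      (∀ k ∈ A, ∀ i, k i < N i) → ∀ (e : Finset (Fin d)) (t : Fin d → ℝ) (x : Torus d),
      ‖mixedDiff l e t (∑ k ∈ A, fun x => (boxBump N k x : ℂ)) x‖
        ≤ ∏ i, (if i ∈ e then C * min 1 (N i * |t i|) ^ l else C) := by
  obtain ⟨C, hC0, hC⟩ := exists_sum_norm_fwdDiff_circleBump_le l
  -- The order-zero case handles the coordinates outside `e`.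
  obtain ⟨D, hD0, hD⟩ := exists_sum_norm_fwdDiff_circleBump_le 0
  refine ⟨max C D, hC0.trans (le_max_left _ _), fun d N A hA e t x => ?_⟩
  set G : (i : Fin d) → ℕ → ℝ := fun i k =>
    ‖(if i ∈ e then (fwdDiff (t i : AddCircle (2 * Real.pi)))^[l]
      (fun z => (circleBump (N i) k z : ℂ)) else fun z => (circleBump (N i) k z : ℂ)) (x i)‖ with hG
  rw [mixedDiff_sum, Finset.sum_apply]
  calc ‖∑ k ∈ A, mixedDiff l e t (fun x => (boxBump N k x : ℂ)) x‖
      ≤ ∑ k ∈ A, ∏ i, G i (k i) := by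
        refine norm_sum_le_of_le _ fun k _ => le_of_eq ?_
        have : (fun x => (boxBump N k x : ℂ))
            = fun x => ∏ i, (fun z => (circleBump (N i) (k i) z : ℂ)) (x i) := by
          funext x; simp [boxBump]
        rw [this, mixedDiff_prod l e t fun i z => (circleBump (N i) (k i) z : ℂ), norm_prod]
    _ ≤ ∑ k ∈ Fintype.piFinset fun i => Finset.range (N i), ∏ i, G i (k i) := by
        refine Finset.sum_le_sum_of_subset_of_nonneg (fun k hk => ?_) fun k _ _ =>
          Finset.prod_nonneg fun i _ => norm_nonneg _
        simpa using hA k hk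
    _ = ∏ i, ∑ k ∈ Finset.range (N i), G i k := (Finset.prod_univ_sum _ _).symm
    _ ≤ _ := by
        refine Finset.prod_le_prod (fun i _ => Finset.sum_nonneg fun k _ => norm_nonneg _)
          fun i _ => ?_
        simp only [hG]
        split_ifs with hi
        · refine (hC (N i) (t i) (x i)).trans ?_
          gcongr
          exact le_max_left _ _
        · refine le_trans ?_ (le_max_right C D)
          simpa using hD (N i) 0 (x i)

end MixedDifferences

/-! ### Two-sided geometric sums over dyadic scales -/

theorem summable_pow_natAbs {ρ : ℝ} (h0 : 0 ≤ ρ) (h1 : ρ < 1) :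
    Summable fun b : ℤ => ρ ^ b.natAbs := by
  refine Summable.of_nat_of_neg ?_ ?_
  · simpa using summable_geometric_of_lt_one h0 h1
  · simpa using summable_geometric_of_lt_one h0 h1

/-- The left side is `2^{-ru}` for `u ≥ 0` and `2^{(l-r)u}` for `u ≤ 0`, so it decays at rate `μ`
both ways; replacing `u` by its floor costs the factor `2^μ`. -/
theorem two_rpow_mul_min_pow_le {r : ℝ} {l : ℕ} {μ : ℝ} (hμ : 0 ≤ μ) (hμr : μ ≤ r)
    (hμl : μ ≤ l - r) (u : ℝ) :
    ((2 : ℝ) ^ u) ^ (-r) * min 1 ((2 : ℝ) ^ u) ^ l ≤ 2 ^ μ * 2 ^ (-μ * |(⌊u⌋ : ℝ)|) := by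
  have hfl : |(⌊u⌋ : ℝ)| ≤ |u| + 1 := by
    have h1 := Int.floor_le u
    have h2 := Int.lt_floor_add_one u
    rw [abs_le]
    constructor <;> linarith [le_abs_self u, neg_abs_le u]
  have hle : ((2 : ℝ) ^ u) ^ (-r) * min 1 ((2 : ℝ) ^ u) ^ l ≤ 2 ^ (-μ * |u|) := by
    rw [← Real.rpow_mul zero_le_two]
    rcases le_total 0 u with hu | hu
    · rw [min_eq_left (Real.one_le_rpow one_le_two hu), one_pow, mul_one]
      refine Real.rpow_le_rpow_of_exponent_le one_le_two ?_
      rw [abs_of_nonneg hu]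
      nlinarith
    · rw [min_eq_right (Real.rpow_le_one_of_one_le_of_nonpos one_le_two hu), ← Real.rpow_natCast,
        ← Real.rpow_mul zero_le_two, ← Real.rpow_add zero_lt_two]
      refine Real.rpow_le_rpow_of_exponent_le one_le_two ?_
      rw [abs_of_nonpos hu]
      nlinarith
  refine hle.trans ?_
  rw [← Real.rpow_add zero_lt_two]
  refine Real.rpow_le_rpow_of_exponent_le one_le_two ?_
  nlinarith

/-- With `τ = 2^v`, the terms divided by `τ^r` decay geometrically on both sides of `a = -v`, so
they are dominated by a convergent series over `ℤ`. -/
theorem exists_sum_two_rpow_mul_min_pow_le {r : ℝ} (hr : 0 < r) {l : ℕ} (hl : r < l) :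
    ∃ K, 0 ≤ K ∧ ∀ (n : ℕ) (τ : ℝ), 0 ≤ τ →
      ∑ a ∈ Finset.range n, (2 : ℝ) ^ (-r * a) * min 1 (2 ^ a * τ) ^ l ≤ K * τ ^ r := by
  set μ := min r (l - r) with hμdef
  have hμ : 0 < μ := lt_min hr (sub_pos.2 hl)
  set ρ : ℝ := 2 ^ (-μ) with hρdef
  have hρ0 : 0 ≤ ρ := by positivity
  have hρ1 : ρ < 1 := Real.rpow_lt_one_of_one_lt_of_neg one_lt_two (neg_lt_zero.2 hμ)
  have hsum := summable_pow_natAbs hρ0 hρ1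
  refine ⟨2 ^ μ * ∑' b : ℤ, ρ ^ b.natAbs,
    mul_nonneg (by positivity) (tsum_nonneg fun b => by positivity), fun n τ hτ => ?_⟩
  rcases hτ.eq_or_lt with rfl | hτ
  · have hl0 : l ≠ 0 := by
      rintro rfl
      simp only [Nat.cast_zero] at hl
      linarith
    simp [hl0, Real.zero_rpow hr.ne']
  set v := Real.logb 2 τ
  have hv : (2 : ℝ) ^ v = τ := Real.rpow_logb two_pos (by norm_num) hτ
  have hterm : ∀ a : ℕ, (2 : ℝ) ^ (-r * a) * min 1 (2 ^ a * τ) ^ l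
      ≤ 2 ^ μ * τ ^ r * ρ ^ (((a : ℤ) + ⌊v⌋).natAbs) := by
    intro a
    have h := two_rpow_mul_min_pow_le hμ.le (min_le_left _ _) (min_le_right _ _) (v + a) (l := l)
      (r := r)
    have h1 : (2 : ℝ) ^ (v + a) = 2 ^ a * τ := by
      rw [Real.rpow_add two_pos, hv, Real.rpow_natCast, mul_comm]
    have h2 : (2 : ℝ) ^ (-μ * |(⌊v + a⌋ : ℝ)|) = ρ ^ (((a : ℤ) + ⌊v⌋).natAbs) := by
      rw [hρdef, ← Real.rpow_natCast, ← Real.rpow_mul zero_le_two, Int.floor_add_natCast,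
        Nat.cast_natAbs]
      push_cast
      rw [add_comm]
    have h3 : (2 : ℝ) ^ (-r * a) = τ ^ r * (2 ^ a * τ) ^ (-r) := by
      rw [← h1, ← hv, ← Real.rpow_mul zero_le_two, ← Real.rpow_mul zero_le_two,
        ← Real.rpow_add two_pos]
      congr 1
      ring
    rw [h1, h2] at h
    rw [h3, mul_assoc]
    calc _ ≤ τ ^ r * (2 ^ μ * ρ ^ (((a : ℤ) + ⌊v⌋).natAbs)) := by gcongr
      _ = _ := by ring
  calc ∑ a ∈ Finset.range n, (2 : ℝ) ^ (-r * a) * min 1 (2 ^ a * τ) ^ l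
      ≤ ∑ a ∈ Finset.range n, 2 ^ μ * τ ^ r * ρ ^ (((a : ℤ) + ⌊v⌋).natAbs) :=
        Finset.sum_le_sum fun a _ => hterm a
    _ = 2 ^ μ * τ ^ r * ∑ a ∈ Finset.range n, ρ ^ (((a : ℤ) + ⌊v⌋).natAbs) := by
        rw [Finset.mul_sum]
    _ = 2 ^ μ * τ ^ r * ∑ b ∈ (Finset.range n).image fun a : ℕ => (a : ℤ) + ⌊v⌋,
          ρ ^ b.natAbs := by
        rw [Finset.sum_image fun a _ b _ hab => by simpa using hab]
    _ ≤ 2 ^ μ * τ ^ r * ∑' b : ℤ, ρ ^ b.natAbs := by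
        gcongr
        exact hsum.sum_le_tsum _ fun b _ => by positivity
    _ = _ := by ring

/-! ### Counting shapes, and the reduction to fooling functions -/

theorem exists_finset_sum_eq_and_le_card {d : ℕ} (hd : 1 ≤ d) (n : ℕ) :
    ∃ S : Finset (Fin d → ℕ), (∀ s ∈ S, ∑ i, s i = n) ∧ ((n : ℝ) / d) ^ (d - 1) ≤ S.card := by
  obtain ⟨d, rfl⟩ : ∃ d', d = d' + 1 := ⟨d - 1, by omega⟩
  -- All coordinates but the first range freely over `[0, M]`; the first absorbs the remainder,
  -- which is nonnegative by the choice of `M`.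
  set M := n / (d + 1) with hM
  set P : Finset (Fin d → ℕ) := Fintype.piFinset fun _ => Finset.range (M + 1) with hP
  let φ : (Fin d → ℕ) → Fin (d + 1) → ℕ := fun a => Fin.cons (n - ∑ i, a i) a
  refine ⟨P.image φ, fun s hs => ?_, ?_⟩
  · obtain ⟨a, ha, rfl⟩ := Finset.mem_image.1 hs
    have ha' : ∀ i, a i ≤ M := fun i =>
      Nat.lt_succ_iff.1 (Finset.mem_range.1 (Fintype.mem_piFinset.1 ha i))
    have h1 : ∑ i, a i ≤ d * M := by
      simpa using Finset.sum_le_card_nsmul Finset.univ a M fun i _ => ha' i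
    have h2 : (d + 1) * M ≤ n := Nat.mul_div_le n (d + 1)
    have h3 : ∑ i, a i ≤ n := by nlinarith
    simp only [φ, Fin.sum_univ_succ, Fin.cons_zero, Fin.cons_succ]
    omega
  · have hinj : Function.Injective φ := fun a b hab => (Fin.cons_injective2 hab).2
    rw [Finset.card_image_of_injective _ hinj, hP, Fintype.card_piFinset]
    simp only [Finset.card_range, Finset.prod_const, Finset.card_univ, Fintype.card_fin,
      Nat.add_sub_cancel]
    push_cast
    gcongr
    rw [div_le_iff₀ (by positivity)]
    have := Nat.lt_mul_div_succ n (Nat.succ_pos d)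
    have h2 : n ≤ (M + 1) * (d + 1) := by
      rw [mul_comm]
      exact this.le
    exact_mod_cast h2

theorem le_optimalRecoveryError_of_forall_exists {Ω : Type*} [TopologicalSpace Ω]
    [MeasurableSpace Ω] [OpensMeasurableSpace Ω] {μ : Measure Ω} {W : Set C(Ω, ℂ)} {m : ℕ}
    {b : ℝ≥0∞} (h : ∀ ξ : Fin m ↪ Ω, ∃ f ∈ W, -f ∈ W ∧ (∀ i, f (ξ i) = 0) ∧ b ≤ eLpNorm f 1 μ) :
    b ≤ optimalRecoveryError μ W 1 m := by
  refine le_iInf₂ fun ξ M => ?_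
  -- With `g` the output on zero data, `2f = (f - g) - (-f - g)`.
  obtain ⟨f, hf, hf', h0, hb⟩ := h ξ
  set X := ⨆ f ∈ W, eLpNorm (fun x => f x - M (fun i => f (ξ i)) x) 1 μ with hX
  set g := M fun _ => 0 with hg
  have hfm : AEStronglyMeasurable f μ := f.continuous.aestronglyMeasurable
  have hgm : AEStronglyMeasurable g μ := Lp.aestronglyMeasurable g
  have h1 : eLpNorm (fun x => f x - g x) 1 μ ≤ X := by
    have := le_iSup₂ (f := fun (f : C(Ω, ℂ)) (_ : f ∈ W) =>
      eLpNorm (fun x => f x - M (fun i => f (ξ i)) x) 1 μ) f hf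
    simpa only [h0] using this
  have h2 : eLpNorm (fun x => -f x - g x) 1 μ ≤ X := by
    have := le_iSup₂ (f := fun (f : C(Ω, ℂ)) (_ : f ∈ W) =>
      eLpNorm (fun x => f x - M (fun i => f (ξ i)) x) 1 μ) (-f) hf'
    simpa only [ContinuousMap.neg_apply, h0, neg_zero] using this
  have h3 : eLpNorm ((2 : ℂ) • (f : Ω → ℂ)) 1 μ ≤ X + X := by
    have heq : (2 : ℂ) • (f : Ω → ℂ) = (fun x => f x - g x) - fun x => -f x - g x := by
      funext x
      simp only [Pi.smul_apply, Pi.sub_apply, smul_eq_mul]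
      ring
    rw [heq]
    exact (eLpNorm_sub_le (hfm.sub hgm) (hfm.neg.sub hgm) le_rfl).trans (add_le_add h1 h2)
  rw [eLpNorm_const_smul] at h3
  have h4 : ‖(2 : ℂ)‖ₑ = 2 := by
    rw [← ofReal_norm]
    simp
  rw [h4, ← two_mul] at h3
  exact hb.trans ((ENNReal.mul_le_mul_iff_right two_ne_zero ENNReal.ofNat_ne_top).1 h3)

/-! ### Fooling functions: class membership and mean value -/

section FoolingFunctions

variable {d : ℕ}

/-- The sum of the bumps on the boxes `k ∈ A s` of the dyadic partitions of shape `s ∈ S`. -/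
noncomputable def dyadicBumpSum (S : Finset (Fin d → ℕ)) (A : (Fin d → ℕ) → Finset (Fin d → ℕ))
    (x : Torus d) : ℝ :=
  ∑ s ∈ S, ∑ k ∈ A s, boxBump (fun i => 2 ^ s i) k x

theorem dyadicBumpSum_nonneg (S : Finset (Fin d → ℕ)) (A : (Fin d → ℕ) → Finset (Fin d → ℕ))
    (x : Torus d) : 0 ≤ dyadicBumpSum S A x :=
  Finset.sum_nonneg fun _ _ => Finset.sum_nonneg fun _ _ => boxBump_nonneg _ _ _

theorem continuous_dyadicBumpSum {S : Finset (Fin d → ℕ)}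
    {A : (Fin d → ℕ) → Finset (Fin d → ℕ)} (hA : ∀ s, ∀ k ∈ A s, ∀ i, k i < 2 ^ s i) :
    Continuous (dyadicBumpSum S A) :=
  continuous_finsetSum _ fun s _ => continuous_finsetSum _ fun k hk =>
    continuous_boxBump (hA s k hk)

theorem exists_norm_mixedDiff_dyadicBumpSum_le (d : ℕ) {r : ℝ} (hr : 0 < r) {l : ℕ} (hl : r < l) :
    ∃ c : ℝ, 0 < c ∧ ∀ (n : ℕ) (S : Finset (Fin d → ℕ)) (A : (Fin d → ℕ) → Finset (Fin d → ℕ)),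
      (∀ s ∈ S, ∑ i, s i = n) → (∀ s, ∀ k ∈ A s, ∀ i, k i < 2 ^ s i) →
      ∀ (e : Finset (Fin d)) (t : Fin d → ℝ) (x : Torus d),
        c * 2 ^ (-r * n) * ‖mixedDiff l e t (fun x => (dyadicBumpSum S A x : ℂ)) x‖
          ≤ ∏ j ∈ e, |t j| ^ r := by
  obtain ⟨C, hC0, hC⟩ := exists_norm_mixedDiff_boxBump_sum_le l
  obtain ⟨K, hK0, hK⟩ := exists_sum_two_rpow_mul_min_pow_le hr hl
  -- The added `1` only makes the constant invertible.
  have hB : 0 < C * K + 1 := by positivity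
  refine ⟨((C * K + 1) ^ d)⁻¹, by positivity, fun n S A hS hA e t x => ?_⟩
  set u : Fin d → ℕ → ℝ := fun i a =>
    2 ^ (-r * a) * (if i ∈ e then C * min 1 (2 ^ a * |t i|) ^ l else C) with hu
  have hu0 : ∀ i a, 0 ≤ u i a := fun i a => by
    simp only [hu]
    split_ifs <;> positivity
  have hlayer : ∀ s ∈ S, (2 : ℝ) ^ (-r * n) *
      ‖mixedDiff l e t (∑ k ∈ A s, fun x => (boxBump (fun i => 2 ^ s i) k x : ℂ)) x‖
      ≤ ∏ i, u i (s i) := by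
    intro s hs
    have h := hC d (fun i => 2 ^ s i) (A s) (hA s) e t x
    push_cast at h
    have hpow : (2 : ℝ) ^ (-r * n) = ∏ i, (2 : ℝ) ^ (-r * s i) := by
      rw [← Real.rpow_sum_of_pos two_pos, ← Finset.mul_sum, ← hS s hs]
      push_cast
      rfl
    rw [hu, Finset.prod_mul_distrib, ← hpow]
    gcongr
  have hfac : ∀ i, ∑ a ∈ Finset.range (n + 1), u i a
      ≤ (C * K + 1) * (if i ∈ e then |t i| ^ r else 1) := by
    intro i
    have hle : ∀ τ : ℝ, 0 ≤ τ →
        ∑ a ∈ Finset.range (n + 1), (2 : ℝ) ^ (-r * a) * (C * min 1 (2 ^ a * τ) ^ l)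
        ≤ (C * K + 1) * τ ^ r := by
      intro τ hτ
      have h1 := mul_le_mul_of_nonneg_left (hK (n + 1) τ hτ) hC0
      have h2 : 0 ≤ τ ^ r := by positivity
      rw [Finset.mul_sum] at h1
      refine (le_of_eq (Finset.sum_congr rfl fun a _ => by ring)).trans (h1.trans ?_)
      nlinarith
    simp only [hu]
    split_ifs with hi
    · exact hle _ (abs_nonneg _)
    -- At `τ = 1` every minimum equals `1`, leaving the plain geometric sum needed for a coordinate
    -- outside `e`.
    · have := hle 1 zero_le_one
      simpa [min_eq_left (one_le_pow₀ (one_le_two (α := ℝ)))] using this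
  have hsum : (fun x => (dyadicBumpSum S A x : ℂ))
      = ∑ s ∈ S, ∑ k ∈ A s, fun x => (boxBump (fun i => 2 ^ s i) k x : ℂ) := by
    funext x
    simp [dyadicBumpSum, Finset.sum_apply]
  have hprod : ∏ i, (if i ∈ e then |t i| ^ r else 1) = ∏ j ∈ e, |t j| ^ r := by
    simp [Finset.prod_ite_mem]
  have key : 2 ^ (-r * n) * ‖mixedDiff l e t (fun x => (dyadicBumpSum S A x : ℂ)) x‖
      ≤ (C * K + 1) ^ d * ∏ j ∈ e, |t j| ^ r := by
    rw [hsum, mixedDiff_sum, Finset.sum_apply]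
    calc _ ≤ ∑ s ∈ S, (2 : ℝ) ^ (-r * n) *
          ‖mixedDiff l e t (∑ k ∈ A s, fun x => (boxBump (fun i => 2 ^ s i) k x : ℂ)) x‖ := by
          rw [← Finset.mul_sum]
          gcongr
          exact norm_sum_le _ _
      _ ≤ ∑ s ∈ S, ∏ i, u i (s i) := Finset.sum_le_sum hlayer
      _ ≤ ∑ s ∈ Fintype.piFinset fun _ : Fin d => Finset.range (n + 1), ∏ i, u i (s i) := by
          refine Finset.sum_le_sum_of_subset_of_nonneg (fun s hs => ?_) fun s _ _ =>
            Finset.prod_nonneg fun i _ => hu0 _ _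
          refine Fintype.mem_piFinset.2 fun i => Finset.mem_range_succ_iff.2 ?_
          rw [← hS s hs]
          exact Finset.single_le_sum (fun j _ => Nat.zero_le (s j)) (Finset.mem_univ i)
      _ = ∏ i, ∑ a ∈ Finset.range (n + 1), u i a := (Finset.prod_univ_sum _ _).symm
      _ ≤ ∏ i, ((C * K + 1) * (if i ∈ e then |t i| ^ r else 1)) :=
          Finset.prod_le_prod (fun i _ => Finset.sum_nonneg fun a _ => hu0 _ _) fun i _ => hfac i
      _ = _ := by rw [Finset.prod_mul_distrib, hprod]; simp
  rw [mul_assoc, inv_mul_le_iff₀ (by positivity)]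
  exact key

theorem le_integral_dyadicBumpSum {S : Finset (Fin d → ℕ)}
    {A : (Fin d → ℕ) → Finset (Fin d → ℕ)} (hA : ∀ s, ∀ k ∈ A s, ∀ i, k i < 2 ^ s i) {n : ℕ}
    (hS : ∀ s ∈ S, ∑ i, s i = n) (hcard : ∀ s ∈ S, 2 ^ n ≤ 2 * (A s).card) :
    S.card * ((∫ y in (0 : ℝ)..1, bumpProfile y) ^ d / 2)
      ≤ ∫ x, dyadicBumpSum S A x ∂torusMeasure d := by
  have : IsFiniteMeasure (torusMeasure d) := by unfold torusMeasure; infer_instance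
  have hint : ∀ s, ∀ k ∈ A s, Integrable (boxBump (fun i => 2 ^ s i) k) (torusMeasure d) :=
    fun s k hk => by
      have := (continuous_boxBump (hA s k hk)).integrable_of_hasCompactSupport
        (μ := torusMeasure d) (HasCompactSupport.of_compactSpace _)
      exact this
  set β := ∫ y in (0 : ℝ)..1, bumpProfile y
  have hβ : 0 < β := integral_bumpProfile_pos
  unfold dyadicBumpSum
  rw [integral_finsetSum _ fun s _ => integrable_finsetSum _ fun k hk => hint s k hk,
    ← nsmul_eq_mul]
  refine Finset.card_nsmul_le_sum _ _ _ fun s hs => ?_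
  rw [integral_finsetSum _ fun k hk => hint s k hk]
  have hk : ∀ k ∈ A s, β ^ d / 2 ^ n ≤ ∫ x, boxBump (fun i => 2 ^ s i) k x ∂torusMeasure d := by
    intro k hk
    have := le_integral_boxBump (hA s k hk)
    push_cast at this
    rwa [Finset.prod_pow_eq_pow_sum, hS s hs] at this
  refine le_trans ?_ (Finset.card_nsmul_le_sum _ _ _ hk)
  rw [nsmul_eq_mul, mul_div_assoc', div_le_div_iff₀ two_pos (by positivity)]
  have : (2 : ℝ) ^ n ≤ 2 * (A s).card := by exact_mod_cast hcard s hs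
  have h2 : 0 ≤ β ^ d := by positivity
  nlinarith

/-- The boxes of the dyadic partition of shape `s` whose bumps vanish at all given points. -/
noncomputable def freeBoxes {m : ℕ} (ξ : Fin m → Torus d) (s : Fin d → ℕ) :
    Finset (Fin d → ℕ) :=
  open Classical in
  {k ∈ Fintype.piFinset fun i => Finset.range (2 ^ s i) |
    ∀ j, boxBump (fun i => 2 ^ s i) k (ξ j) = 0}

theorem lt_of_mem_freeBoxes {m : ℕ} {ξ : Fin m → Torus d} {s k : Fin d → ℕ}
    (hk : k ∈ freeBoxes ξ s) (i : Fin d) : k i < 2 ^ s i := by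
  simp only [freeBoxes, Finset.mem_filter, Fintype.mem_piFinset, Finset.mem_range] at hk
  exact hk.1 i

/-- Bumps of one shape have disjoint supports up to boundaries, so each node spoils at most one box.
-/
theorem two_pow_le_card_freeBoxes_add {m : ℕ} (ξ : Fin m → Torus d) (s : Fin d → ℕ) :
    2 ^ ∑ i, s i ≤ (freeBoxes ξ s).card + m := by
  classical
  set P := Fintype.piFinset fun i => Finset.range (2 ^ s i) with hP
  have hPc : P.card = 2 ^ ∑ i, s i := by
    simp [hP, Fintype.card_piFinset, Finset.prod_pow_eq_pow_sum]
  have hb : ∀ j, (P.filter fun k => boxBump (fun i => 2 ^ s i) k (ξ j) ≠ 0).card ≤ 1 := by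
    refine fun j => Finset.card_le_one.2 fun a ha b hb => ?_
    simp only [hP, Finset.mem_filter, Fintype.mem_piFinset, Finset.mem_range] at ha hb
    exact eq_of_boxBump_ne_zero ha.1 hb.1 ha.2 hb.2
  have hsub : P ⊆ freeBoxes ξ s ∪
      Finset.univ.biUnion fun j => P.filter fun k => boxBump (fun i => 2 ^ s i) k (ξ j) ≠ 0 := by
    intro k hk
    by_cases h : ∀ j, boxBump (fun i => 2 ^ s i) k (ξ j) = 0
    · refine Finset.mem_union_left _ ?_
      simp only [freeBoxes, Finset.mem_filter]
      exact ⟨hk, h⟩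
    · push Not at h
      obtain ⟨j, hj⟩ := h
      exact Finset.mem_union_right _ (Finset.mem_biUnion.2
        ⟨j, Finset.mem_univ j, Finset.mem_filter.2 ⟨hk, hj⟩⟩)
  rw [← hPc]
  refine (Finset.card_le_card hsub).trans ((Finset.card_union_le _ _).trans ?_)
  gcongr
  simpa using Finset.card_biUnion_le_card_mul Finset.univ _ 1 fun j _ => hb j

theorem dyadicBumpSum_freeBoxes_eq_zero {m : ℕ} (ξ : Fin m → Torus d) (S : Finset (Fin d → ℕ))
    (j : Fin m) : dyadicBumpSum S (freeBoxes ξ) (ξ j) = 0 := by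
  refine Finset.sum_eq_zero fun s _ => Finset.sum_eq_zero fun k hk => ?_
  simp only [freeBoxes, Finset.mem_filter] at hk
  exact hk.2 j

end FoolingFunctions

/-! ### Assembly of the lower bound -/

theorem neg_mem_classHInfty {d : ℕ} {r : ℝ} {f : C(Torus d, ℂ)} (hf : f ∈ classHInfty d r) :
    -f ∈ classHInfty d r := by
  intro e t x
  have h : ((-f : C(Torus d, ℂ)) : Torus d → ℂ) = (-1 : ℂ) • (f : Torus d → ℂ) := by
    funext y
    simp
  rw [h, mixedDiff_const_smul]
  simpa using hf e t x

theorem exists_fooling_function {d : ℕ} (hd : 1 ≤ d) {r : ℝ} (hr : 0 < r) :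
    ∃ c : ℝ, 0 < c ∧ ∀ (m n : ℕ), 2 * m ≤ 2 ^ n → ∀ ξ : Fin m → Torus d,
      ∃ f ∈ classHInfty d r, (∀ i, f (ξ i) = 0) ∧
        ENNReal.ofReal (c * 2 ^ (-r * n) * (n : ℝ) ^ (d - 1)) ≤ eLpNorm f 1 (torusMeasure d) := by
  obtain ⟨c, hc, hmem⟩ := exists_norm_mixedDiff_dyadicBumpSum_le d hr
    (l := ⌊r⌋₊ + 1) (by exact_mod_cast Nat.lt_floor_add_one r)
  set β := ∫ y in (0 : ℝ)..1, bumpProfile y with hβdef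
  have hβ : 0 < β := integral_bumpProfile_pos
  have hd' : (0 : ℝ) < d := by exact_mod_cast hd
  -- `c` normalizes into the class, the power of `d` comes from counting shapes, and `β ^ d / 2` is
  -- the mean of one layer with half its boxes free.
  refine ⟨c * (((d : ℝ) ^ (d - 1))⁻¹ * (β ^ d / 2)), by positivity, fun m n hmn ξ => ?_⟩
  obtain ⟨S, hS, hScard⟩ := exists_finset_sum_eq_and_le_card hd n
  have hA : ∀ s, ∀ k ∈ freeBoxes ξ s, ∀ i, k i < 2 ^ s i := fun s k hk => lt_of_mem_freeBoxes hk
  have hcont := continuous_dyadicBumpSum (S := S) hA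
  set w : ℝ := c * 2 ^ (-r * n) with hw
  have hw0 : 0 < w := by positivity
  let f : C(Torus d, ℂ) := ⟨fun x => ((w * dyadicBumpSum S (freeBoxes ξ) x : ℝ) : ℂ),
    Complex.continuous_ofReal.comp (continuous_const.mul hcont)⟩
  have hf : (f : Torus d → ℂ)
      = (w : ℂ) • fun x => (dyadicBumpSum S (freeBoxes ξ) x : ℂ) := by
    funext x
    simp [f]
  refine ⟨f, fun e t x => ?_, fun i => ?_, ?_⟩
  · rw [hf, mixedDiff_const_smul, Pi.smul_apply, norm_smul, Complex.norm_real, Real.norm_eq_abs,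
      abs_of_pos hw0]
    exact hmem n S _ hS hA e t x
  · simp [f, dyadicBumpSum_freeBoxes_eq_zero]
  · have : IsFiniteMeasure (torusMeasure d) := by unfold torusMeasure; infer_instance
    have hint : Integrable (dyadicBumpSum S (freeBoxes ξ)) (torusMeasure d) :=
      hcont.integrable_of_hasCompactSupport (HasCompactSupport.of_compactSpace _)
    have hnn : ∀ x, 0 ≤ w * dyadicBumpSum S (freeBoxes ξ) x := fun x =>
      mul_nonneg hw0.le (dyadicBumpSum_nonneg _ _ _)
    have hnorm : eLpNorm f 1 (torusMeasure d)
        = ENNReal.ofReal (∫ x, w * dyadicBumpSum S (freeBoxes ξ) x ∂torusMeasure d) := by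
      rw [eLpNorm_one_eq_lintegral_enorm,
        ofReal_integral_eq_lintegral_ofReal (hint.const_mul w) (Filter.Eventually.of_forall hnn)]
      refine lintegral_congr fun x => ?_
      rw [← ofReal_norm]
      simp only [f, ContinuousMap.coe_mk, Complex.norm_real, Real.norm_eq_abs, abs_of_nonneg (hnn x)]
    have hlow := le_integral_dyadicBumpSum hA hS fun s hs => by
      have := two_pow_le_card_freeBoxes_add ξ s
      rw [hS s hs] at this
      omega
    rw [hnorm, integral_const_mul]
    refine ENNReal.ofReal_le_ofReal ?_
    calc c * (((d : ℝ) ^ (d - 1))⁻¹ * (β ^ d / 2)) * 2 ^ (-r * n) * (n : ℝ) ^ (d - 1)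
        = w * (((n : ℝ) / d) ^ (d - 1) * (β ^ d / 2)) := by rw [hw, div_pow]; ring
      _ ≤ w * (S.card * (β ^ d / 2)) := by gcongr
      _ ≤ _ := by gcongr

theorem proposition1p2 (d : ℕ) (hd : 1 ≤ d) (r : ℝ) (hr : 0 < r) :
    ∃ c : ℝ, 0 < c ∧ ∀ m : ℕ, 1 ≤ m →
      ENNReal.ofReal (c * (m : ℝ) ^ (-r) * Real.log m ^ (d - 1)) ≤
        optimalRecoveryError (torusMeasure d) (classHInfty d r) 1 m := by
  obtain ⟨c, hc, h⟩ := exists_fooling_function hd hr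
  refine ⟨c * 4 ^ (-r), by positivity, fun m hm => ?_⟩
  refine le_optimalRecoveryError_of_forall_exists fun ξ => ?_
  -- This gives `2m < 2^n ≤ 4m`: the first inequality leaves half the boxes free, the second
  -- produces the factor `4^{-r}`.
  set n := Nat.log 2 m + 2 with hn
  have hlow : 2 ^ Nat.log 2 m ≤ m := Nat.pow_log_le_self 2 (by omega)
  have hup : m < 2 ^ (Nat.log 2 m + 1) := Nat.lt_pow_succ_log_self one_lt_two m
  have h2n : 2 ^ n = 4 * 2 ^ Nat.log 2 m := by rw [hn, pow_add]; ring
  obtain ⟨f, hf, hf0, hfn⟩ := h m n (by rw [h2n]; rw [pow_succ] at hup; omega) ξ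
  refine ⟨f, hf, neg_mem_classHInfty hf, hf0, le_trans (ENNReal.ofReal_le_ofReal ?_) hfn⟩
  have hm0 : (0 : ℝ) < m := by exact_mod_cast hm
  have hlog0 : 0 ≤ Real.log m := Real.log_nonneg (by exact_mod_cast hm)
  have hlog : Real.log m ≤ n := by
    have h1 : (m : ℝ) ≤ 2 ^ n := by
      have : m ≤ 2 ^ n := hup.le.trans (Nat.pow_le_pow_right two_pos (by omega))
      exact_mod_cast this
    calc Real.log m ≤ Real.log (2 ^ n) := Real.log_le_log hm0 h1
      _ = n * Real.log 2 := Real.log_pow _ _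
      _ ≤ n := mul_le_of_le_one_right (by positivity) (by linarith [Real.log_two_lt_d9])
  have hpow : (4 : ℝ) ^ (-r) * (m : ℝ) ^ (-r) ≤ 2 ^ (-r * n) := by
    have h1 : (2 : ℝ) ^ n ≤ 4 * m := by
      have : 2 ^ n ≤ 4 * m := by omega
      exact_mod_cast this
    rw [← Real.mul_rpow (by norm_num) hm0.le, mul_comm (-r), Real.rpow_mul zero_le_two,
      Real.rpow_natCast]
    exact Real.rpow_le_rpow_of_nonpos (by positivity) h1 (by linarith)
  calc c * 4 ^ (-r) * (m : ℝ) ^ (-r) * Real.log m ^ (d - 1)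
      = c * (4 ^ (-r) * (m : ℝ) ^ (-r)) * Real.log m ^ (d - 1) := by ring
    _ ≤ c * 2 ^ (-r * n) * (n : ℝ) ^ (d - 1) := by gcongr
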